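/- Let $n \ge 0$. A \emph{binary tree} with $n$ nodes is a complete rooted planar binary tree with $n$ internal nodes (and $n+1$ leaves); $\perp$ denotes the empty tree. Its \emph{canopy} $\operatorname{cnp}(T)$ is the word of length $n-1$ (empty if $n\le 1$) obtained by reading the leaves of $T$ from left to right, except the first and the last one, writing $0$ for a leaf that is a right child and $1$ for a leaf that is a left child. A \emph{pair of twin binary trees} with $n$ nodes is a pair $(T_L,T_R)$ of binary trees with $n$ nodes each such that $\operatorname{cnp}(T_L)_i \ne \operatorname{cnp}(T_R)_i$ for all $1\le i\le n-1$. Let $\mathcal{TBT}_n$ be the set of these pairs. \emph{Baxter order.} Write permutations of size $n$ as words on $\{1,\dots,n\}$ and let $\le_P$ be the permutohedron order on them, the reflexive and transitive closure of the relation between $u\,a\,b\,v$ and $u\,b\,a\,v$, where $a<b$ are letters and $u,v$ are words. For a permutation $\sigma$, let $\mathsf P(\sigma)=(T_L,T_R)$ be the pair of shapes of the binary search trees obtained from $\perp$ by inserting at the leaves the letters of $\sigma$, from left to right for $T_L$ and from right to left for $T_R$. For $J_0,J_1\in\mathcal{TBT}_n$, the order relation of the Baxter lattice is: $J_0\le_B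 J_1$ if and only if there are permutations $\sigma,\nu$ of size $n$ with $\sigma\le_P\nu$, $\mathsf P(\sigma)=J_0$ and $\mathsf P(\nu)=J_1$. \emph{Twin Tamari diagrams.} A \emph{Tamari diagram} of length $n$ is a word $\delta=\delta_1\cdots\delta_n$ of integers such that $0\le\delta_i\le n-i$ for all $1\le i\le n$, and $\delta_{i+j}\le\delta_i-j$ for all $1\le i\le n$ and $1\le j\le\delta_i$. A \emph{twin Tamari diagram} of size $n$ is a pair $\delta=(\delta^L,\delta^R)$ of Tamari diagrams of length $n$ such that for all $1\le i\le n-1$ exactly one of $\delta^L_i$ and $\delta^R_i$ is zero. Its word $\omega(\delta)$ of length $n$ is defined by $\omega(\delta)_i=-\delta^L_i$ if $\delta^L_i\neq 0$ and $\omega(\delta)_i=\delta^R_i$ otherwise. For a binary tree $T$, let $\operatorname{td}(T)$ be the word obtained by labeling each node by the number of nodes of its right subtree and reading the labels in inorder, and let $\operatorname{ttd}(T_L,T_R)=(\operatorname{td}(T_L),\operatorname{td}(T_R))$. \textbf{Proposition.} For every $n\ge 0$: (1) the map $\operatorname{ttd}$ is a bijection from $\mathcal{TBT}_n$ onto the set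 of twin Tamari diagrams of size $n$; (2) for all $J_0,J_1\in\mathcal{TBT}_n$, $$J_0\le_B J_1\quad\text{if and only if}\quad \omega(\operatorname{ttd}(J_0))_i\le\omega(\operatorname{ttd}(J_1))_i\ \text{ for all } 1\le i\le n.$$ -/

import Mathlib

namespace Baxter

/-! Words are lists; `letter w i` is the `i`-th letter `w_i` of `w`, for `1 ≤ i ≤ |w|`. -/

/-- The `i`-th letter of a word, counted from `1` (only used for `1 ≤ i ≤ w.length`). -/
def letter {α : Type} [Zero α] (w : List α) (i : ℕ) : α := w.getD (i - 1) 0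

/-! ### Binary trees

Unlabeled binary trees are `BinaryTree Unit`, trees labeled by letters are `BinaryTree ℕ`;
`BinaryTree.nil` is the empty tree (a leaf) and `BinaryTree.numNodes` counts the internal nodes. -/

/-- The shape of a labeled binary tree. -/
def shape (T : BinaryTree ℕ) : BinaryTree Unit := T.map fun _ => ()

/-- The orientations of the leaves from left to right, for a tree hanging on an edge with
orientation `o`: `0` for a right-oriented leaf, `1` for a left-oriented one. -/
def leafOrientations {α : Type} : Fin 2 → BinaryTree α → List (Fin 2)
  | o, .nil => [o]
  | _, .node _ L R => leafOrientations 1 L ++ leafOrientations 0 R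

/-- The canopy: orientations of all leaves except the first and the last one. The value given to
the root edge is irrelevant: it only matters for the empty tree, whose unique leaf is dropped. -/
def canopy {α : Type} (T : BinaryTree α) : List (Fin 2) :=
  (leafOrientations 0 T).tail.dropLast

/-- The pairs of twin binary trees with `n` nodes (in each tree). -/
def twinBinaryTrees (n : ℕ) : Set (BinaryTree Unit × BinaryTree Unit) :=
  {J | J.1.numNodes = n ∧ J.2.numNodes = n ∧
    ∀ i : ℕ, 1 ≤ i → i + 1 ≤ n → letter (canopy J.1) i ≠ letter (canopy J.2) i}

/-! ### Permutations and the permutohedron order -/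

/-- `σ` is a permutation of size `n`, written as a word on the letters `1, …, n`. -/
def IsPermutation (n : ℕ) (σ : List ℕ) : Prop := σ.Perm (List.range' 1 n)

/-- `σ = u a b v` and `ν = u b a v` for words `u`, `v` and letters `a < b`. -/
def PermutohedronCover (σ ν : List ℕ) : Prop :=
  ∃ (u v : List ℕ) (a b : ℕ), a < b ∧ σ = u ++ a :: b :: v ∧ ν = u ++ b :: a :: v

/-- The (right) permutohedron order. -/
def PermutohedronLE : List ℕ → List ℕ → Prop := Relation.ReflTransGen PermutohedronCover

/-! ### The P-symbol -/

/-- Leaf insertion of a letter into a left binary search tree. -/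
def leftInsert (a : ℕ) : BinaryTree ℕ → BinaryTree ℕ
  | .nil => .node a .nil .nil
  | .node b L R => if a < b then .node b (leftInsert a L) R else .node b L (leftInsert a R)

/-- Leaf insertion of a letter into a right binary search tree. -/
def rightInsert (a : ℕ) : BinaryTree ℕ → BinaryTree ℕ
  | .nil => .node a .nil .nil
  | .node b L R => if a ≤ b then .node b (rightInsert a L) R else .node b L (rightInsert a R)

/-- The Baxter P-symbol `(T_L, T_R)` of a word: `T_L` is obtained by leaf insertions in a left
binary search tree from left to right, `T_R` by leaf insertions in a right binary search tree from
right to left. -/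
def pSymbol (u : List ℕ) : BinaryTree ℕ × BinaryTree ℕ :=
  (u.foldl (fun T a => leftInsert a T) .nil, u.foldr rightInsert .nil)

/-! ### The Baxter order -/

/-- The order relation of the Baxter lattice on pairs of twin binary trees with `n` nodes: the
quotient of the permutohedron order along the (shape of the) P-symbol. -/
def BaxterLE (n : ℕ) (J₀ J₁ : BinaryTree Unit × BinaryTree Unit) : Prop :=
  ∃ σ ν : List ℕ, IsPermutation n σ ∧ IsPermutation n ν ∧ PermutohedronLE σ ν ∧
    Prod.map shape shape (pSymbol σ) = J₀ ∧ Prod.map shape shape (pSymbol ν) = J₁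

/-! ### Twin Tamari diagrams -/

/-- The Tamari diagram of a binary tree: each node is labeled by the number of nodes of its right
subtree, and the labels are read in inorder. -/
def td {α : Type} : BinaryTree α → List ℕ
  | .nil => []
  | .node _ L R => td L ++ R.numNodes :: td R

/-- Tamari diagrams of length `n`: words `δ` with `0 ≤ δ_i ≤ n - i` for `1 ≤ i ≤ n` and
`δ_{i+j} ≤ δ_i - j` for `1 ≤ i ≤ n` and `1 ≤ j ≤ δ_i`. -/
def IsTamariDiagram (n : ℕ) (δ : List ℕ) : Prop :=
  δ.length = n ∧
  (∀ i, 1 ≤ i → i ≤ n → letter δ i + i ≤ n) ∧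
  ∀ i j, 1 ≤ i → i ≤ n → 1 ≤ j → j ≤ letter δ i → letter δ (i + j) + j ≤ letter δ i

/-- Twin Tamari diagrams of size `n`: pairs of Tamari diagrams of length `n` such that, for each
`1 ≤ i ≤ n - 1`, exactly one of the two `i`-th letters is zero. -/
def twinTamariDiagrams (n : ℕ) : Set (List ℕ × List ℕ) :=
  {δ | IsTamariDiagram n δ.1 ∧ IsTamariDiagram n δ.2 ∧
    ∀ i, 1 ≤ i → i + 1 ≤ n → Xor (letter δ.1 i = 0) (letter δ.2 i = 0)}

/-- `ttd(T_L, T_R) = (td(T_L), td(T_R))`. -/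
def ttd (J : BinaryTree Unit × BinaryTree Unit) : List ℕ × List ℕ := (td J.1, td J.2)

/-- The word `ω(δ)`: its `i`-th letter is `-δ^L_i` if `δ^L_i ≠ 0`, and `δ^R_i` otherwise. -/
def omegaWord (δ : List ℕ × List ℕ) : List ℤ :=
  List.zipWith (fun l r : ℕ => if l ≠ 0 then -(l : ℤ) else (r : ℤ)) δ.1 δ.2

end Baxter

/-! For a permutation `w`, the `i`-th letter of the left diagram of its twin trees is the length of
the longest run `i + 1, …, i + k` of letters all placed after `i` in `w` (`runLength_td_leftTree`).
Reversing `w` gives the right diagram, with "before" in place of "after". Going up in the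
permutohedron only adds inversions, so left runs shrink and right runs grow. This is the comparison
of the words `ω`, since the sign of a letter of `ω` tells which of the two runs is nonzero.

Conversely, given two comparable twin diagrams, build permutations `σ` and `ν` by inserting the
letters `n, n - 1, …, 1`. The Tamari inequalities guarantee that each new letter has an admissible
place (`rel_of_runLength`). Inserting as early as possible in `σ` and as late as possible in `ν`
keeps every inversion of `σ` an inversion of `ν` (`exists_isCompatible_of_le`), whence `σ ≤_P ν`
(`permutohedronLE_of_inversions`).

The same construction with two equal diagrams gives surjectivity of `ttd`. Injectivity holds for
each tree separately, and the twin condition transfers because the zeros of the canopy are those of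
the Tamari diagram. -/

namespace Baxter

/-! ### Tamari diagrams and canopies of binary trees -/

section Trees

variable {α β : Type}

lemma length_td (T : BinaryTree α) : (td T).length = T.numNodes := by
  induction T with
  | nil => rfl
  | node a L R hL hR => simp [td, hL, hR]; omega

lemma numNodes_map (f : α → β) (T : BinaryTree α) : (T.map f).numNodes = T.numNodes := by
  induction T with
  | nil => rfl
  | node a L R hL hR => simp [BinaryTree.map, hL, hR]

lemma td_map (f : α → β) (T : BinaryTree α) : td (T.map f) = td T := by
  induction T with
  | nil => rfl
  | node a L R hL hR => simp [BinaryTree.map, td, hL, hR, numNodes_map]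

lemma td_node_getD_of_lt (a : α) (L R : BinaryTree α) {t : ℕ} (h : t < L.numNodes) :
    (td (.node a L R)).getD t 0 = (td L).getD t 0 := by
  rw [td, List.getD_append _ _ _ _ (by rwa [length_td])]

lemma td_node_getD_root (a : α) (L R : BinaryTree α) :
    (td (.node a L R)).getD L.numNodes 0 = R.numNodes := by
  rw [td, List.getD_append_right _ _ _ _ (by rw [length_td])]
  simp [length_td]

lemma td_node_getD_add (a : α) (L R : BinaryTree α) (t : ℕ) :
    (td (.node a L R)).getD (L.numNodes + 1 + t) 0 = (td R).getD t 0 := by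
  rw [td, List.getD_append_right _ _ _ _ (by rw [length_td]; omega), length_td,
    show L.numNodes + 1 + t - L.numNodes = t + 1 by omega, List.getD_cons_succ]

lemma td_getD_add_lt (T : BinaryTree α) {t : ℕ} (h : t < T.numNodes) :
    (td T).getD t 0 + t < T.numNodes := by
  induction T generalizing t with
  | nil => simp at h
  | node a L R hL hR =>
    simp only [BinaryTree.numNodes] at h ⊢
    rcases lt_trichotomy t L.numNodes with h1 | rfl | h1
    · rw [td_node_getD_of_lt _ _ _ h1]
      have := hL h1
      omega
    · rw [td_node_getD_root]; omega
    · obtain ⟨s, rfl⟩ := Nat.exists_eq_add_of_le (Nat.succ_le_of_lt h1)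
      rw [Nat.succ_eq_add_one, td_node_getD_add]
      have := @hR s (by omega)
      omega

lemma td_getD_add_le (T : BinaryTree α) {t j : ℕ} (ht : t < T.numNodes) (hj : 1 ≤ j)
    (h : j ≤ (td T).getD t 0) : (td T).getD (t + j) 0 + j ≤ (td T).getD t 0 := by
  induction T generalizing t with
  | nil => simp at ht
  | node a L R hL hR =>
    simp only [BinaryTree.numNodes] at ht
    rcases lt_trichotomy t L.numNodes with h1 | rfl | h1
    · rw [td_node_getD_of_lt _ _ _ h1] at h ⊢
      have := td_getD_add_lt L h1
      rw [td_node_getD_of_lt _ _ _ (by omega)]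
      exact hL h1 h
    · rw [td_node_getD_root] at h ⊢
      obtain ⟨s, rfl⟩ := Nat.exists_eq_add_of_le hj
      rw [show L.numNodes + (1 + s) = L.numNodes + 1 + s by omega, td_node_getD_add]
      have := @td_getD_add_lt _ R s (by omega)
      omega
    · obtain ⟨s, rfl⟩ := Nat.exists_eq_add_of_le (Nat.succ_le_of_lt h1)
      rw [Nat.succ_eq_add_one] at *
      rw [td_node_getD_add] at h ⊢
      rw [add_assoc, td_node_getD_add]
      exact hR (by omega) h

lemma isTamariDiagram_td (T : BinaryTree α) : IsTamariDiagram T.numNodes (td T) := by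
  refine ⟨length_td T, fun i h1 h2 => ?_, fun i j h1 h2 h3 h4 => ?_⟩
  · have := @td_getD_add_lt _ T (i - 1) (by omega)
    rw [letter]
    omega
  · have := @td_getD_add_le _ T (i - 1) j (by omega) h3 h4
    rwa [show i - 1 + j = i + j - 1 by omega] at this

/-- The root is the first position whose right subtree reaches the end of the word: by
`td_getD_add_lt`, those of the nodes of `L` stop inside `L`. So the word determines where to cut it.
-/
lemma td_injective : Function.Injective (td : BinaryTree Unit → List ℕ) := by
  intro T T' h
  induction T generalizing T' with
  | nil =>
    cases T' with
    | nil => rfl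
    | node a L R => simp [td] at h
  | node a L R hL hR =>
    cases T' with
    | nil => simp [td] at h
    | node a' L' R' =>
      have hn : L.numNodes + R.numNodes = L'.numNodes + R'.numNodes := by
        have := congrArg List.length h
        simp only [length_td, BinaryTree.numNodes] at this
        omega
      have h1 := td_node_getD_root a L R
      have h2 := td_node_getD_root a' L' R'
      have hLL : L.numNodes = L'.numNodes := by
        rcases lt_trichotomy L.numNodes L'.numNodes with hl | hl | hl
        · rw [h, td_node_getD_of_lt _ _ _ hl] at h1
          have := td_getD_add_lt L' hl
          omega
        · exact hl
        · rw [← h, td_node_getD_of_lt _ _ _ hl] at h2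
          have := td_getD_add_lt L hl
          omega
      have := List.append_inj h (by rw [length_td, length_td, hLL])
      rw [hL this.1, hR (List.cons.inj this.2).2]

/-! ### Canopies and zeros of Tamari diagrams. -/

lemma length_leafOrientations (o : Fin 2) (T : BinaryTree α) :
    (leafOrientations o T).length = T.numNodes + 1 := by
  induction T generalizing o with
  | nil => rfl
  | node a L R hL hR => simp [leafOrientations, hL, hR]; omega

lemma leafOrientations_getD_zero (o : Fin 2) (T : BinaryTree α) :
    (leafOrientations o T).getD 0 0 = if T.numNodes = 0 then o else 1 := by
  induction T generalizing o with
  | nil => rfl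
  | node a L R hL hR =>
    rw [leafOrientations, List.getD_append _ _ _ _ (by rw [length_leafOrientations]; omega), hL]
    simp

/-- The leaf that follows an inorder node is the leftmost leaf of its right subtree; it is a right
child exactly when that subtree is empty. -/
lemma leafOrientations_getD_succ (o : Fin 2) (T : BinaryTree α) {t : ℕ} (ht : t < T.numNodes) :
    (leafOrientations o T).getD (t + 1) 0 = 0 ↔ (td T).getD t 0 = 0 := by
  induction T generalizing t o with
  | nil => simp at ht
  | node a L R hL hR =>
    simp only [BinaryTree.numNodes] at ht
    rw [leafOrientations]
    rcases lt_trichotomy t L.numNodes with h1 | rfl | h1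
    · rw [td_node_getD_of_lt _ _ _ h1,
        List.getD_append _ _ _ _ (by rw [length_leafOrientations]; omega), hL _ h1]
    · rw [td_node_getD_root, List.getD_append_right _ _ _ _ (by rw [length_leafOrientations]),
        length_leafOrientations, Nat.sub_self, leafOrientations_getD_zero]
      split_ifs with h <;> simp [h]
    · obtain ⟨s, rfl⟩ := Nat.exists_eq_add_of_le (Nat.succ_le_of_lt h1)
      rw [Nat.succ_eq_add_one, td_node_getD_add,
        List.getD_append_right _ _ _ _ (by rw [length_leafOrientations]; omega),
        length_leafOrientations, ← hR 0 (t := s) (by omega)]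
      rw [show L.numNodes + 1 + s + 1 - (L.numNodes + 1) = s + 1 by omega]

lemma letter_canopy_eq_zero_iff (T : BinaryTree α) {i : ℕ} (h1 : 1 ≤ i) (h2 : i < T.numNodes) :
    letter (canopy T) i = 0 ↔ letter (td T) i = 0 := by
  obtain ⟨t, rfl⟩ := Nat.exists_eq_add_of_le' h1
  rw [letter, letter, Nat.add_sub_cancel, ← leafOrientations_getD_succ 0 T (by omega), canopy,
    List.getD_eq_getElem?_getD, List.getD_eq_getElem?_getD, List.getElem?_dropLast,
    List.getElem?_tail, if_pos]
  rw [List.length_tail, length_leafOrientations]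
  omega

end Trees

lemma mem_twinBinaryTrees_iff {n : ℕ} {J : BinaryTree Unit × BinaryTree Unit} :
    J ∈ twinBinaryTrees n ↔ ttd J ∈ twinTamariDiagrams n := by
  have key : J.1.numNodes = n → J.2.numNodes = n → ∀ i, 1 ≤ i → i + 1 ≤ n →
      (letter (canopy J.1) i ≠ letter (canopy J.2) i ↔
        Xor (letter (td J.1) i = 0) (letter (td J.2) i = 0)) := by
    intro h1 h2 i hi hn
    rw [← letter_canopy_eq_zero_iff _ hi (by omega), ← letter_canopy_eq_zero_iff _ hi (by omega)]
    generalize letter (canopy J.1) i = a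
    generalize letter (canopy J.2) i = b
    revert a b
    unfold Xor
    decide
  constructor
  · rintro ⟨h1, h2, h⟩
    exact ⟨h1 ▸ isTamariDiagram_td J.1, h2 ▸ isTamariDiagram_td J.2,
      fun i hi hn => (key h1 h2 i hi hn).1 (h i hi hn)⟩
  · rintro ⟨h1, h2, h⟩
    have e1 : J.1.numNodes = n := (length_td _).symm.trans h1.1
    have e2 : J.2.numNodes = n := (length_td _).symm.trans h2.1
    exact ⟨e1, e2, fun i hi hn => (key e1 e2 i hi hn).2 (h i hi hn)⟩

/-! ### Positions of letters in words -/

lemma idxOf_filter_lt_iff {α : Type} [DecidableEq α] {p : α → Bool} {w : List α} {a b : α}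
    (ha : a ∈ w.filter p) (hb : b ∈ w.filter p) :
    (w.filter p).idxOf a < (w.filter p).idxOf b ↔ w.idxOf a < w.idxOf b := by
  induction w with
  | nil => simp at ha
  | cons x w ih => grind

lemma idxOf_add_idxOf_reverse {α : Type} [DecidableEq α] {w : List α} (hw : w.Nodup) {a : α}
    (ha : a ∈ w) : w.idxOf a + w.reverse.idxOf a + 1 = w.length := by
  induction w with
  | nil => simp at ha
  | cons x w ih =>
    rw [List.reverse_cons, List.idxOf_append, List.idxOf_cons]
    grind

lemma idxOf_reverse_lt_iff {α : Type} [DecidableEq α] {w : List α} (hw : w.Nodup) {a b : α}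
    (ha : a ∈ w) (hb : b ∈ w) :
    w.reverse.idxOf a < w.reverse.idxOf b ↔ w.idxOf b < w.idxOf a := by
  have := idxOf_add_idxOf_reverse hw ha
  have := idxOf_add_idxOf_reverse hw hb
  omega

/-- No membership is needed: an absent letter has the length of the word as index, which also grows
by one. -/
lemma idxOf_append_cons_of_ne {α : Type} [DecidableEq α] {u v : List α} {c a : α} (h : a ≠ c) :
    (u ++ c :: v).idxOf a =
      if (u ++ v).idxOf a < u.length then (u ++ v).idxOf a else (u ++ v).idxOf a + 1 := by
  by_cases ha : a ∈ u
  · have := List.idxOf_lt_length_of_mem ha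
    rw [List.idxOf_append_of_mem ha, List.idxOf_append_of_mem ha, if_pos this]
  · rw [List.idxOf_append_of_notMem ha, List.idxOf_append_of_notMem ha,
      List.idxOf_cons_ne _ h.symm, if_neg (by omega)]
    rfl

lemma idxOf_append_cons_self {α : Type} [DecidableEq α] {u v : List α} {c : α} (h : c ∉ u) :
    (u ++ c :: v).idxOf c = u.length := by
  rw [List.idxOf_append_of_notMem h, List.idxOf_cons_self, add_zero]

lemma mem_iff_of_perm_range' {w : List ℕ} {s n a : ℕ} (hw : w.Perm (List.range' s n)) :
    a ∈ w ↔ s ≤ a ∧ a < s + n := by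
  rw [hw.mem_iff, List.mem_range'_1]

lemma perm_range'_iff {w : List ℕ} {s n : ℕ} :
    w.Perm (List.range' s n) ↔ w.Nodup ∧ ∀ a, a ∈ w ↔ s ≤ a ∧ a < s + n := by
  refine ⟨fun h => ⟨h.nodup_iff.2 List.nodup_range', fun a => mem_iff_of_perm_range' h⟩,
    fun h => (List.perm_ext_iff_of_nodup h.1 List.nodup_range').2 fun a => ?_⟩
  rw [h.2, List.mem_range'_1]

/-! ### The permutohedron order and inversions -/

lemma PermutohedronLE.cons {σ ν : List ℕ} (h : PermutohedronLE σ ν) (c : ℕ) :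
    PermutohedronLE (c :: σ) (c :: ν) := by
  induction h with
  | refl => exact .refl
  | tail _ hc ih =>
    obtain ⟨u, v, a, b, hab, rfl, rfl⟩ := hc
    exact ih.tail ⟨c :: u, v, a, b, hab, rfl, rfl⟩

lemma permutohedronLE_append_cons {u v : List ℕ} {b : ℕ} (h : ∀ x ∈ u, x < b) :
    PermutohedronLE (u ++ b :: v) (b :: (u ++ v)) := by
  induction u with
  | nil => exact .refl
  | cons x u ih =>
    exact ((ih fun y hy => h y (List.mem_cons_of_mem _ hy)).cons x).tail
      ⟨[], u ++ v, x, b, h x List.mem_cons_self, rfl, rfl⟩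

/-- Let `b` be the first letter of `ν`. A larger letter before `b` in `σ` would be an inversion
absent from `ν`, so `b` can be moved to the front of `σ` by upward covers. Deleting `b` from both
words preserves the hypothesis. -/
lemma permutohedronLE_of_inversions {σ ν : List ℕ} (hν : ν.Nodup) (hp : σ.Perm ν)
    (h : ∀ a ∈ ν, ∀ b ∈ ν, a < b → σ.idxOf b < σ.idxOf a → ν.idxOf b < ν.idxOf a) :
    PermutohedronLE σ ν := by
  induction ν generalizing σ with
  | nil => rw [hp.eq_nil]; exact .refl
  | cons b ν ih =>
    have hσ : σ.Nodup := hp.nodup_iff.2 hν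
    obtain ⟨u, v, rfl⟩ := List.append_of_mem (hp.mem_iff.2 List.mem_cons_self)
    have hp' : (u ++ v).Perm ν := (List.perm_middle.symm.trans hp).cons_inv
    have hb : b ∉ ν := (List.nodup_cons.1 hν).1
    have hbuv : b ∉ u ++ v := fun hm => hb (hp'.mem_iff.1 hm)
    have hu : ∀ x ∈ u, x < b := by
      intro x hx
      have hxν : x ∈ ν := hp'.mem_iff.1 (List.mem_append_left _ hx)
      by_contra hlt
      have hne : b ≠ x := fun e => hb (e ▸ hxν)
      have := h b List.mem_cons_self x (List.mem_cons_of_mem _ hxν) (by omega) (by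
        have := List.idxOf_lt_length_of_mem hx
        rw [List.idxOf_append_of_mem hx,
          idxOf_append_cons_self fun hm => hbuv (List.mem_append_left _ hm)]
        exact this)
      simp at this
    refine (permutohedronLE_append_cons hu).trans
      (PermutohedronLE.cons (ih (List.nodup_cons.1 hν).2 hp' fun x hx y hy hxy hlt => ?_) b)
    have := h x (List.mem_cons_of_mem _ hx) y (List.mem_cons_of_mem _ hy) hxy (by
      rw [idxOf_append_cons_of_ne (ne_of_mem_of_not_mem hx hb),
        idxOf_append_cons_of_ne (ne_of_mem_of_not_mem hy hb)]
      split_ifs <;> omega)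
    rw [List.idxOf_cons_ne _ (ne_of_mem_of_not_mem hx hb).symm,
      List.idxOf_cons_ne _ (ne_of_mem_of_not_mem hy hb).symm] at this
    omega

lemma PermutohedronCover.perm {σ ν : List ℕ} (h : PermutohedronCover σ ν) : σ.Perm ν := by
  obtain ⟨u, v, a, b, -, rfl, rfl⟩ := h
  exact (List.Perm.swap b a v).append_left u

lemma PermutohedronCover.idxOf_lt {σ ν : List ℕ} (h : PermutohedronCover σ ν) (hσ : σ.Nodup)
    {a b : ℕ} (hab : a < b) (hlt : σ.idxOf b < σ.idxOf a) : ν.idxOf b < ν.idxOf a := by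
  obtain ⟨u, v, c, d, hcd, rfl, rfl⟩ := h
  have hcu : c ∉ u := by grind
  have hdu : d ∉ u := by grind
  have key : ∀ x, x ≠ c → x ≠ d → (u ++ d :: c :: v).idxOf x = (u ++ c :: d :: v).idxOf x := by
    intro x hc hd
    rw [List.idxOf_append, List.idxOf_append, List.idxOf_cons_ne _ hd.symm,
      List.idxOf_cons_ne _ hc.symm, List.idxOf_cons_ne (b := c) _ hc.symm,
      List.idxOf_cons_ne _ hd.symm]
  have h1 : (u ++ c :: d :: v).idxOf c = u.length := idxOf_append_cons_self hcu
  have h2 : (u ++ d :: c :: v).idxOf d = u.length := idxOf_append_cons_self hdu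
  have h3 : (u ++ c :: d :: v).idxOf d = u.length + 1 := by
    rw [List.idxOf_append_of_notMem hdu, List.idxOf_cons_ne _ hcd.ne, List.idxOf_cons_self]
  have h4 : (u ++ d :: c :: v).idxOf c = u.length + 1 := by
    rw [List.idxOf_append_of_notMem hcu, List.idxOf_cons_ne _ hcd.ne', List.idxOf_cons_self]
  -- No other letter occupies the two exchanged positions, so only the relative order of `c` and `d`
  -- changes.
  have h5 : ∀ x, x ≠ c → (u ++ c :: d :: v).idxOf x ≠ u.length := by
    intro x hx he
    exact hx ((List.idxOf_inj (by simp : c ∈ u ++ c :: d :: v)).1 (h1.trans he.symm)).symm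
  have h6 : ∀ x, x ≠ d → (u ++ c :: d :: v).idxOf x ≠ u.length + 1 := by
    intro x hx he
    exact hx ((List.idxOf_inj (by simp : d ∈ u ++ c :: d :: v)).1 (h3.trans he.symm)).symm
  have ka := key a
  have kb := key b
  have ha5 := h5 a
  have hb5 := h5 b
  have ha6 := h6 a
  have hb6 := h6 b
  by_cases a = c <;> by_cases a = d <;> by_cases b = c <;> by_cases b = d <;> subst_vars <;> omega

lemma PermutohedronLE.idxOf_lt {σ ν : List ℕ} (h : PermutohedronLE σ ν) (hσ : σ.Nodup)
    {a b : ℕ} (hab : a < b) (hlt : σ.idxOf b < σ.idxOf a) : ν.idxOf b < ν.idxOf a := by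
  suffices H : ν.Nodup ∧ ν.idxOf b < ν.idxOf a from H.2
  induction h with
  | refl => exact ⟨hσ, hlt⟩
  | tail _ hc ih => exact ⟨hc.perm.nodup_iff.1 ih.1, hc.idxOf_lt ih.1 hab ih.2⟩

/-! ### Runs of letters and the trees of the P-symbol -/

/-- `k` is the largest integer such that `i` is smaller than `i + 1, …, i + k` for `r`, among the
letters that are at most `N`. -/
structure RunLength (r : ℕ → ℕ → Prop) (N i k : ℕ) : Prop where
  add_le : i + k ≤ N
  rel : ∀ m, 1 ≤ m → m ≤ k → r i (i + m)
  rel_succ : i + k + 1 ≤ N → r (i + k + 1) i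

/-- The letter that stops the `r`-run cannot lie in the `r'`-run. With `r = r'` this gives
uniqueness, with the orders of two words it gives monotonicity. -/
lemma RunLength.le {r r' : ℕ → ℕ → Prop} {N i k k' : ℕ} (h : RunLength r N i k)
    (h' : RunLength r' N i k') (H : ∀ j, i < j → j ≤ N → r j i → ¬ r' i j) : k' ≤ k := by
  by_contra hlt
  have h1 := h'.add_le
  exact H _ (by omega) (by omega) (h.rel_succ (by omega)) (h'.rel (k + 1) (by omega) (by omega))

/-- The tree obtained by leaf insertions from left to right. -/
def leftTree (w : List ℕ) : BinaryTree ℕ := w.foldl (fun T a => leftInsert a T) .nil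

lemma foldl_leftInsert_node (w : List ℕ) (a : ℕ) (L R : BinaryTree ℕ) :
    w.foldl (fun T a => leftInsert a T) (.node a L R) =
      .node a ((w.filter (· < a)).foldl (fun T a => leftInsert a T) L)
        ((w.filter (a ≤ ·)).foldl (fun T a => leftInsert a T) R) := by
  induction w generalizing L R with
  | nil => rfl
  | cons x w ih =>
    rw [List.foldl_cons, leftInsert]
    split_ifs with h
    · rw [ih, List.filter_cons_of_pos (by simpa using h), List.filter_cons_of_neg (by simpa using h)]
      rfl
    · rw [ih, List.filter_cons_of_neg (by simpa using h), List.filter_cons_of_pos (by simpa using h)]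
      rfl

lemma leftTree_cons (a : ℕ) (w : List ℕ) :
    leftTree (a :: w) = .node a (leftTree (w.filter (· < a))) (leftTree (w.filter (a ≤ ·))) :=
  foldl_leftInsert_node w a .nil .nil

lemma numNodes_leftInsert (a : ℕ) (T : BinaryTree ℕ) :
    (leftInsert a T).numNodes = T.numNodes + 1 := by
  induction T with
  | nil => rfl
  | node b L R hL hR =>
    rw [leftInsert]
    split_ifs <;> simp [hL, hR] <;> omega

lemma numNodes_leftTree (w : List ℕ) : (leftTree w).numNodes = w.length := by
  induction w using List.reverseRecOn with
  | nil => rfl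
  | append_singleton w a ih =>
    rw [leftTree, List.foldl_append, List.foldl_cons, List.foldl_nil, numNodes_leftInsert,
      ← leftTree, ih, List.length_append, List.length_singleton]

/-- The root is the first letter `a`, and the subtrees come from the subwords of smaller and of
larger letters; the interval `range' s n` is arbitrary so that these are of the same form. The run
of `a` reaches the top, and `a` stops any run that starts below it. -/
lemma runLength_td_leftTree {w : List ℕ} {s n : ℕ} (hw : w.Perm (List.range' s n)) {i : ℕ}
    (h1 : s ≤ i) (h2 : i < s + n) :
    RunLength (fun a b => w.idxOf a < w.idxOf b) (s + n - 1) i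
      ((td (leftTree w)).getD (i - s) 0) := by
  induction hlen : w.length using Nat.strong_induction_on generalizing w s n i with
  | _ N ih =>
    cases w with
    | nil => have := hw.length_eq; simp at this; omega
    | cons a w =>
      have hn : w.length + 1 = n := by simpa using hw.length_eq
      rw [List.length_cons] at hlen
      obtain ⟨hnd, hmem⟩ := perm_range'_iff.1 hw
      obtain ⟨ha, hwn⟩ := List.nodup_cons.1 hnd
      obtain ⟨ha1, ha2⟩ := (hmem a).1 List.mem_cons_self
      have hmem' : ∀ b, b ∈ w ↔ s ≤ b ∧ b < s + n ∧ b ≠ a := by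
        intro b
        have := hmem b
        rw [List.mem_cons] at this
        grind
      have hidx : ∀ b, b ≠ a → (a :: w).idxOf b = w.idxOf b + 1 := fun b hb =>
        List.idxOf_cons_ne _ (Ne.symm hb)
      have hL : (w.filter (· < a)).Perm (List.range' s (a - s)) := by
        refine perm_range'_iff.2 ⟨hwn.filter _, fun b => ?_⟩
        rw [List.mem_filter, hmem', decide_eq_true_iff]
        omega
      have hR : (w.filter (a ≤ ·)).Perm (List.range' (a + 1) (s + n - 1 - a)) := by
        refine perm_range'_iff.2 ⟨hwn.filter _, fun b => ?_⟩
        rw [List.mem_filter, hmem', decide_eq_true_iff]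
        omega
      have hLn : (leftTree (w.filter (· < a))).numNodes = a - s := by
        rw [numNodes_leftTree, hL.length_eq, List.length_range']
      have hRn : (leftTree (w.filter (a ≤ ·))).numNodes = s + n - 1 - a := by
        rw [numNodes_leftTree, hR.length_eq, List.length_range']
      rw [leftTree_cons]
      rcases lt_trichotomy i a with hia | rfl | hia
      · rw [td_node_getD_of_lt _ _ _ (by omega)]
        have hrun := ih _ (by have := List.length_filter_le (· < a) w; omega) hL h1
          (by omega) rfl
        have hfil : ∀ b c, s ≤ b → b < a → s ≤ c → c < a →
            ((w.filter (· < a)).idxOf b < (w.filter (· < a)).idxOf c ↔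
              (a :: w).idxOf b < (a :: w).idxOf c) := by
          intro b c hb1 hb2 hc1 hc2
          rw [idxOf_filter_lt_iff ((mem_iff_of_perm_range' hL).2 (by omega))
            ((mem_iff_of_perm_range' hL).2 (by omega)), hidx _ (by omega), hidx _ (by omega)]
          omega
        have hle := hrun.add_le
        refine ⟨by omega, fun m hm1 hm2 => (hfil _ _ (by omega) (by omega) (by omega)
          (by omega)).1 (hrun.rel m hm1 hm2), fun hs => ?_⟩
        -- A run exhausting the left interval is stopped by the root, the first letter of the word;
        -- otherwise the stopping letter is found in the left subword.
        rcases eq_or_ne (i + (td (leftTree (w.filter (· < a)))).getD (i - s) 0 + 1) a with he | he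
        · rw [he, List.idxOf_cons_self, hidx i (by omega)]
          omega
        · exact (hfil _ _ (by omega) (by omega) (by omega) (by omega)).1
            (hrun.rel_succ (by omega))
      · rw [← hLn, td_node_getD_root, hRn]
        refine ⟨by omega, fun m hm1 hm2 => ?_, fun hs => by omega⟩
        rw [List.idxOf_cons_self, hidx _ (by omega)]
        omega
      · have hrun := ih _ (by have := List.length_filter_le (a ≤ ·) w; omega) hR hia
          (by omega) rfl
        rw [show i - s = (leftTree (w.filter (· < a))).numNodes + 1 + (i - (a + 1)) by omega,
          td_node_getD_add]
        have hfil : ∀ b c, a < b → b < s + n → a < c → c < s + n →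
            ((w.filter (a ≤ ·)).idxOf b < (w.filter (a ≤ ·)).idxOf c ↔
              (a :: w).idxOf b < (a :: w).idxOf c) := by
          intro b c hb1 hb2 hc1 hc2
          rw [idxOf_filter_lt_iff ((mem_iff_of_perm_range' hR).2 (by omega))
            ((mem_iff_of_perm_range' hR).2 (by omega)), hidx _ (by omega), hidx _ (by omega)]
          omega
        have hle := hrun.add_le
        exact ⟨by omega, fun m hm1 hm2 => (hfil _ _ (by omega) (by omega) (by omega)
          (by omega)).1 (hrun.rel m hm1 hm2), fun hs =>
          (hfil _ _ (by omega) (by omega) (by omega) (by omega)).1 (hrun.rel_succ (by omega))⟩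

/-- The labels of a tree, in inorder. -/
def labels : BinaryTree ℕ → List ℕ
  | .nil => []
  | .node a L R => labels L ++ a :: labels R

lemma mem_labels_leftInsert {a b : ℕ} {T : BinaryTree ℕ} :
    b ∈ labels (leftInsert a T) ↔ b = a ∨ b ∈ labels T := by
  induction T with
  | nil => simp [leftInsert, labels]
  | node c L R hL hR =>
    rw [leftInsert]
    split_ifs <;> simp [labels, hL, hR] <;> tauto

lemma rightInsert_eq_leftInsert {a : ℕ} {T : BinaryTree ℕ} (h : a ∉ labels T) :
    rightInsert a T = leftInsert a T := by
  induction T with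
  | nil => rfl
  | node b L R hL hR =>
    simp only [labels, List.mem_append, List.mem_cons, not_or] at h
    have : a ≤ b ↔ a < b := ⟨fun hle => lt_of_le_of_ne hle h.2.1, le_of_lt⟩
    rw [rightInsert, leftInsert, hL h.1, hR h.2.2]
    simp only [this]

lemma foldr_rightInsert {w : List ℕ} (hw : w.Nodup) :
    w.foldr rightInsert .nil = leftTree w.reverse := by
  -- The two insertions differ only on ties, so the induction must also track the labels to know
  -- that each inserted letter is new.
  suffices H : w.foldr rightInsert .nil = leftTree w.reverse ∧
      ∀ a, a ∈ labels (leftTree w.reverse) ↔ a ∈ w from H.1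
  induction w with
  | nil => simp [leftTree, labels]
  | cons x w ih =>
    obtain ⟨hx, hwn⟩ := List.nodup_cons.1 hw
    obtain ⟨h1, h2⟩ := ih hwn
    have h3 : leftTree (x :: w).reverse = leftInsert x (leftTree w.reverse) := by
      rw [List.reverse_cons, leftTree, List.foldl_append]
      rfl
    refine ⟨?_, fun a => ?_⟩
    · rw [List.foldr_cons, h1, h3, rightInsert_eq_leftInsert fun h => hx ((h2 x).1 h)]
    · rw [h3, mem_labels_leftInsert, h2, List.mem_cons]

lemma length_of_isPermutation {n : ℕ} {w : List ℕ} (hw : IsPermutation n w) : w.length = n := by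
  rw [List.Perm.length_eq hw, List.length_range']

/-- The pair of twin binary trees of a permutation. -/
def twinTrees (w : List ℕ) : BinaryTree Unit × BinaryTree Unit :=
  Prod.map shape shape (pSymbol w)

lemma ttd_twinTrees_fst (w : List ℕ) : (ttd (twinTrees w)).1 = td (leftTree w) :=
  td_map _ _

lemma ttd_twinTrees_snd {w : List ℕ} (hw : w.Nodup) :
    (ttd (twinTrees w)).2 = td (leftTree w.reverse) := by
  rw [← foldr_rightInsert hw]
  exact td_map _ _

lemma runLength_ttd_fst {n : ℕ} {w : List ℕ} (hw : IsPermutation n w) {i : ℕ} (h1 : 1 ≤ i)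
    (h2 : i ≤ n) : RunLength (fun a b => w.idxOf a < w.idxOf b) n i
      (letter (ttd (twinTrees w)).1 i) := by
  have := runLength_td_leftTree hw h1 (by omega)
  rw [Nat.add_sub_cancel_left] at this
  rwa [letter, ttd_twinTrees_fst]

lemma runLength_ttd_snd {n : ℕ} {w : List ℕ} (hw : IsPermutation n w) {i : ℕ} (h1 : 1 ≤ i)
    (h2 : i ≤ n) : RunLength (fun a b => w.idxOf b < w.idxOf a) n i
      (letter (ttd (twinTrees w)).2 i) := by
  have := runLength_td_leftTree ((List.reverse_perm w).trans hw) h1 (by omega)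
  rw [Nat.add_sub_cancel_left] at this
  have hw' := perm_range'_iff.1 hw
  have hmem : ∀ a, 1 ≤ a → a ≤ n → a ∈ w := fun a h3 h4 => (hw'.2 a).2 (by omega)
  have hle := this.add_le
  rw [letter, ttd_twinTrees_snd hw'.1]
  refine ⟨hle, fun m hm1 hm2 => ?_, fun h => ?_⟩
  · exact (idxOf_reverse_lt_iff hw'.1 (hmem _ (by omega) (by omega)) (hmem _ (by omega)
      (by omega))).1 (this.rel m hm1 hm2)
  · exact (idxOf_reverse_lt_iff hw'.1 (hmem _ (by omega) (by omega)) (hmem _ (by omega)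
      (by omega))).1 (this.rel_succ h)

lemma length_ttd_twinTrees {n : ℕ} {w : List ℕ} (hw : IsPermutation n w) :
    (ttd (twinTrees w)).1.length = n ∧ (ttd (twinTrees w)).2.length = n := by
  rw [ttd_twinTrees_fst, ttd_twinTrees_snd (perm_range'_iff.1 hw).1, length_td, length_td,
    numNodes_leftTree, numNodes_leftTree, List.length_reverse, length_of_isPermutation hw]
  exact ⟨rfl, rfl⟩

/-! ### Permutations with a given twin Tamari diagram -/

lemma exists_insert {w : List ℕ} {c p : ℕ} (hc : c ∉ w) (hp : p ≤ w.length) :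
    ∃ w' : List ℕ, w'.Perm (c :: w) ∧
      (∀ a ∈ w, ∀ b ∈ w, w'.idxOf a < w'.idxOf b ↔ w.idxOf a < w.idxOf b) ∧
      (∀ a ∈ w, w'.idxOf a < w'.idxOf c ↔ w.idxOf a < p) ∧
      ∀ a ∈ w, w'.idxOf c < w'.idxOf a ↔ p ≤ w.idxOf a := by
  have hlen : (w.take p).length = p := List.length_take_of_le hp
  have h0 : (w.take p ++ c :: w.drop p).idxOf c = p := by
    rw [idxOf_append_cons_self fun h => hc (List.mem_of_mem_take h), hlen]
  have h1 : ∀ a ∈ w, (w.take p ++ c :: w.drop p).idxOf a =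
      if w.idxOf a < p then w.idxOf a else w.idxOf a + 1 := by
    intro a ha
    rw [idxOf_append_cons_of_ne (ne_of_mem_of_not_mem ha hc), List.take_append_drop, hlen]
  refine ⟨w.take p ++ c :: w.drop p, ?_, fun a ha b hb => ?_, fun a ha => ?_, fun a ha => ?_⟩
  · exact List.perm_middle.trans (by rw [List.take_append_drop])
  · rw [h1 a ha, h1 b hb]
    split_ifs <;> omega
  · rw [h1 a ha, h0]
    split_ifs <;> omega
  · rw [h1 a ha, h0]
    split_ifs <;> omega

/-- The letters of a twin Tamari diagram `(l, r)` of size `n`. -/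
structure IsTwinDiagram (n : ℕ) (l r : ℕ → ℕ) : Prop where
  left_add_le : ∀ i, 1 ≤ i → i ≤ n → l i + i ≤ n
  right_add_le : ∀ i, 1 ≤ i → i ≤ n → r i + i ≤ n
  left_tamari : ∀ i j, 1 ≤ i → i ≤ n → 1 ≤ j → j ≤ l i → l (i + j) + j ≤ l i
  right_tamari : ∀ i j, 1 ≤ i → i ≤ n → 1 ≤ j → j ≤ r i → r (i + j) + j ≤ r i
  eq_zero_iff : ∀ i, 1 ≤ i → i + 1 ≤ n → (l i = 0 ↔ r i ≠ 0)

/-- A word on the letters `s + 1, …, n` whose runs are given by `(l, r)`. -/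
structure IsCompatible (n : ℕ) (l r : ℕ → ℕ) (s : ℕ) (w : List ℕ) : Prop where
  nodup : w.Nodup
  mem_iff : ∀ a, a ∈ w ↔ s < a ∧ a ≤ n
  left : ∀ i, s < i → i ≤ n → RunLength (fun a b => w.idxOf a < w.idxOf b) n i (l i)
  right : ∀ i, s < i → i ≤ n → RunLength (fun a b => w.idxOf b < w.idxOf a) n i (r i)

/-- By the Tamari inequality, the run of `i + m` stays within `i + k`. The letter stopping it is
either `i + k + 1` or some `i + m'` with `m < m' ≤ k`; iterate and use transitivity. The relation is
abstract so as to serve both diagrams. -/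
lemma rel_of_runLength {rel : ℕ → ℕ → Prop} (htrans : ∀ a b c, rel a b → rel b c → rel a c)
    {n i k : ℕ} {d : ℕ → ℕ} (hk : i + k + 1 ≤ n)
    (hd : ∀ m, 1 ≤ m → m ≤ k → RunLength rel n (i + m) (d (i + m)))
    (ht : ∀ m, 1 ≤ m → m ≤ k → d (i + m) + m ≤ k) {m : ℕ} (h1 : 1 ≤ m) (h2 : m ≤ k) :
    rel (i + k + 1) (i + m) := by
  induction hj : k - m using Nat.strong_induction_on generalizing m with
  | _ j ih =>
    have h3 := ht m h1 h2
    have h4 := (hd m h1 h2).rel_succ (by omega)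
    rcases eq_or_ne (d (i + m) + m) k with he | he
    · rwa [show i + m + d (i + m) + 1 = i + k + 1 by omega] at h4
    · rw [show i + m + d (i + m) + 1 = i + (m + d (i + m) + 1) by omega] at h4
      exact htrans _ _ _ (ih _ (by omega) (by omega) (by omega) rfl) h4

section

variable {n s : ℕ} {l r : ℕ → ℕ} {w : List ℕ}

/-- This leaves room to place `s + 1` after the letter that stops its left run and before the whole
run. -/
lemma IsCompatible.idxOf_lt_left (hw : IsCompatible n l r (s + 1) w) (hd : IsTwinDiagram n l r)
    (hs : s + 1 + l (s + 1) + 1 ≤ n) {m : ℕ} (h1 : 1 ≤ m) (h2 : m ≤ l (s + 1)) :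
    w.idxOf (s + 1 + l (s + 1) + 1) < w.idxOf (s + 1 + m) :=
  rel_of_runLength (rel := fun a b => w.idxOf a < w.idxOf b) (fun _ _ _ => lt_trans) hs
    (fun m _ _ => hw.left _ (by omega) (by omega))
    (fun m _ _ => hd.left_tamari _ _ (by omega) (by omega) (by omega) (by omega)) h1 h2

lemma IsCompatible.idxOf_lt_right (hw : IsCompatible n l r (s + 1) w) (hd : IsTwinDiagram n l r)
    (hs : s + 1 ≤ n) {m : ℕ} (h1 : 1 ≤ m) (h2 : m ≤ r (s + 1)) :
    w.idxOf (s + 1 + m) < w.idxOf (s + 1 + r (s + 1) + 1) := by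
  rcases Nat.lt_or_ge n (s + 1 + r (s + 1) + 1) with h | h
  · have h3 := hd.right_add_le (s + 1) (by omega) hs
    -- Here the stopping letter would be `n + 1`; being absent, it has index `w.length`, beyond all
    -- the letters.
    rw [List.idxOf_eq_length (a := s + 1 + r (s + 1) + 1) fun hm => by
      have := ((hw.mem_iff _).1 hm).2
      omega]
    exact List.idxOf_lt_length_of_mem ((hw.mem_iff _).2 (by omega))
  · exact rel_of_runLength (rel := fun a b => w.idxOf b < w.idxOf a)
      (fun _ _ _ h h' => lt_trans h' h) h
      (fun m _ _ => hw.right _ (by omega) (by omega))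
      (fun m _ _ => hd.right_tamari _ _ (by omega) (by omega) (by omega) (by omega)) h1 h2

/-- The four conditions on `p` give `s + 1` the prescribed runs. Runs of larger letters involve only
larger letters, whose relative order is unchanged. -/
lemma IsCompatible.exists_insert (hw : IsCompatible n l r (s + 1) w) (hd : IsTwinDiagram n l r)
    (hs : s + 1 ≤ n) {p : ℕ} (hp : p ≤ w.length)
    (hl : ∀ m, 1 ≤ m → m ≤ l (s + 1) → p ≤ w.idxOf (s + 1 + m))
    (hl' : s + 1 + l (s + 1) + 1 ≤ n → w.idxOf (s + 1 + l (s + 1) + 1) < p)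
    (hr : ∀ m, 1 ≤ m → m ≤ r (s + 1) → w.idxOf (s + 1 + m) < p)
    (hr' : s + 1 + r (s + 1) + 1 ≤ n → p ≤ w.idxOf (s + 1 + r (s + 1) + 1)) :
    ∃ w', IsCompatible n l r s w' ∧
      (∀ a b, s + 1 < a → a ≤ n → s + 1 < b → b ≤ n →
        (w'.idxOf a < w'.idxOf b ↔ w.idxOf a < w.idxOf b)) ∧
      ∀ a, s + 1 < a → a ≤ n → (w'.idxOf a < w'.idxOf (s + 1) ↔ w.idxOf a < p) := by
  have hc : s + 1 ∉ w := fun h => lt_irrefl _ ((hw.mem_iff _).1 h).1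
  have hm : ∀ a, s + 1 < a → a ≤ n → a ∈ w := fun a h1 h2 => (hw.mem_iff a).2 ⟨h1, h2⟩
  obtain ⟨w', h1, h2, h3, h4⟩ := Baxter.exists_insert hc hp
  have hL := hd.left_add_le (s + 1) (by omega) hs
  have hR := hd.right_add_le (s + 1) (by omega) hs
  refine ⟨w', ⟨h1.nodup_iff.2 (List.nodup_cons.2 ⟨hc, hw.nodup⟩), fun a => ?_, fun i hi hin => ?_,
    fun i hi hin => ?_⟩, fun a b ha ha' hb hb' => h2 a (hm a ha ha') b (hm b hb hb'),
    fun a ha ha' => h3 a (hm a ha ha')⟩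
  · rw [h1.mem_iff, List.mem_cons, hw.mem_iff]
    omega
  · rcases eq_or_ne i (s + 1) with rfl | hne
    · exact ⟨by omega, fun m hm1 hm2 => (h4 _ (hm _ (by omega) (by omega))).2 (hl m hm1 hm2),
        fun h => (h3 _ (hm _ (by omega) h)).2 (hl' h)⟩
    · have := hw.left i (by omega) hin
      have hle := this.add_le
      exact ⟨hle, fun m hm1 hm2 => (h2 _ (hm _ (by omega) (by omega)) _ (hm _ (by omega)
        (by omega))).2 (this.rel m hm1 hm2), fun h => (h2 _ (hm _ (by omega) (by omega)) _
        (hm _ (by omega) (by omega))).2 (this.rel_succ h)⟩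
  · rcases eq_or_ne i (s + 1) with rfl | hne
    · exact ⟨by omega, fun m hm1 hm2 => (h3 _ (hm _ (by omega) (by omega))).2 (hr m hm1 hm2),
        fun h => (h4 _ (hm _ (by omega) h)).2 (hr' h)⟩
    · have := hw.right i (by omega) hin
      have hle := this.add_le
      exact ⟨hle, fun m hm1 hm2 => (h2 _ (hm _ (by omega) (by omega)) _ (hm _ (by omega)
        (by omega))).2 (this.rel m hm1 hm2), fun h => (h2 _ (hm _ (by omega) (by omega)) _
        (hm _ (by omega) (by omega))).2 (this.rel_succ h)⟩

/-- Insertion of `s + 1` as early as possible. -/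
lemma IsCompatible.exists_insert_early (hw : IsCompatible n l r (s + 1) w)
    (hd : IsTwinDiagram n l r) (hs : s + 1 ≤ n) :
    ∃ w', IsCompatible n l r s w' ∧
      (∀ a b, s + 1 < a → a ≤ n → s + 1 < b → b ≤ n →
        (w'.idxOf a < w'.idxOf b ↔ w.idxOf a < w.idxOf b)) ∧
      ∀ a, s + 1 < a → a ≤ n → w'.idxOf a < w'.idxOf (s + 1) →
        (0 < l (s + 1) ∧ s + 1 + l (s + 1) + 1 ≤ n ∧
          w.idxOf a ≤ w.idxOf (s + 1 + l (s + 1) + 1)) ∨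
        (l (s + 1) = 0 ∧ ∃ m, 1 ≤ m ∧ m ≤ r (s + 1) ∧ w.idxOf a ≤ w.idxOf (s + 1 + m)) := by
  have hz := hd.eq_zero_iff (s + 1) (by omega)
  have hL := hd.left_add_le (s + 1) (by omega) hs
  have hR := hd.right_add_le (s + 1) (by omega) hs
  have hlen : ∀ a, s + 1 < a → a ≤ n → w.idxOf a < w.length := fun a h1 h2 =>
    List.idxOf_lt_length_of_mem ((hw.mem_iff a).2 ⟨h1, h2⟩)
  rcases Nat.eq_zero_or_pos (l (s + 1)) with h0 | h0
  · rcases Nat.eq_zero_or_pos (r (s + 1)) with h0' | h0'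
    -- Both runs vanish only for `s + 1 = n`.
    · obtain ⟨w', h1, h2, h3⟩ := hw.exists_insert hd hs (p := 0) (by omega) (by omega)
        (by omega) (by omega) (by omega)
      exact ⟨w', h1, h2, fun a ha ha' h => absurd ((h3 a ha ha').1 h) (by omega)⟩
    -- The earliest place is just after the last letter of the right run.
    · obtain ⟨m, hm, hmax⟩ := Finset.exists_max_image (Finset.Icc 1 (r (s + 1)))
        (fun m => w.idxOf (s + 1 + m)) ⟨1, Finset.mem_Icc.2 ⟨le_rfl, h0'⟩⟩
      obtain ⟨hm1, hm2⟩ := Finset.mem_Icc.1 hm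
      obtain ⟨w', h1, h2, h3⟩ := hw.exists_insert hd hs (p := w.idxOf (s + 1 + m) + 1)
        (hlen _ (by omega) (by omega)) (by omega)
        (fun _ => by
          rw [h0]
          exact Nat.lt_succ_of_le (hmax 1 (Finset.mem_Icc.2 ⟨le_rfl, h0'⟩)))
        (fun m' h4 h5 => Nat.lt_succ_of_le (hmax m' (Finset.mem_Icc.2 ⟨h4, h5⟩)))
        (fun _ => hw.idxOf_lt_right hd hs hm1 hm2)
      exact ⟨w', h1, h2, fun a ha ha' h =>
        .inr ⟨h0, m, hm1, hm2, Nat.le_of_lt_succ ((h3 a ha ha').1 h)⟩⟩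
  · rcases Nat.lt_or_ge n (s + 1 + l (s + 1) + 1) with h | h
    · obtain ⟨w', h1, h2, h3⟩ := hw.exists_insert hd hs (p := 0) (by omega) (by omega)
        (by omega) (by omega) (by omega)
      exact ⟨w', h1, h2, fun a ha ha' h => absurd ((h3 a ha ha').1 h) (by omega)⟩
    -- The earliest place is just after the letter that stops the left run.
    · have hr0 : r (s + 1) = 0 := by omega
      obtain ⟨w', h1, h2, h3⟩ := hw.exists_insert hd hs
        (p := w.idxOf (s + 1 + l (s + 1) + 1) + 1) (hlen _ (by omega) h)
        (fun m hm1 hm2 => hw.idxOf_lt_left hd h hm1 hm2) (fun _ => Nat.lt_succ_self _)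
        (by omega) (fun _ => by
          rw [hr0]
          exact hw.idxOf_lt_left hd h le_rfl h0)
      exact ⟨w', h1, h2, fun a ha ha' h' =>
        .inl ⟨h0, h, Nat.le_of_lt_succ ((h3 a ha ha').1 h')⟩⟩

/-- Insertion of `s + 1` as late as possible. -/
lemma IsCompatible.exists_insert_late (hw : IsCompatible n l r (s + 1) w)
    (hd : IsTwinDiagram n l r) (hs : s + 1 ≤ n) :
    ∃ w', IsCompatible n l r s w' ∧
      (∀ a b, s + 1 < a → a ≤ n → s + 1 < b → b ≤ n →
        (w'.idxOf a < w'.idxOf b ↔ w.idxOf a < w.idxOf b)) ∧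
      ∀ a, s + 1 < a → a ≤ n →
        (∀ m, 1 ≤ m → m ≤ l (s + 1) → w.idxOf a < w.idxOf (s + 1 + m)) →
        (l (s + 1) = 0 → w.idxOf a < w.idxOf (s + 1 + r (s + 1) + 1)) →
        w'.idxOf a < w'.idxOf (s + 1) := by
  have hz := hd.eq_zero_iff (s + 1) (by omega)
  have hL := hd.left_add_le (s + 1) (by omega) hs
  have hR := hd.right_add_le (s + 1) (by omega) hs
  rcases Nat.eq_zero_or_pos (l (s + 1)) with h0 | h0
  -- The latest place is just before the letter that stops the right run, or the end of the word if
  -- that letter is `n + 1`.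
  · obtain ⟨w', h1, h2, h3⟩ := hw.exists_insert hd hs
      (p := w.idxOf (s + 1 + r (s + 1) + 1)) List.idxOf_le_length (by omega)
      (fun _ => by
        rw [h0]
        exact hw.idxOf_lt_right hd hs (m := 1) le_rfl (by omega))
      (fun m hm1 hm2 => hw.idxOf_lt_right hd hs hm1 hm2) (fun _ => le_rfl)
    exact ⟨w', h1, h2, fun a ha ha' _ h => (h3 a ha ha').2 (h h0)⟩
  -- The latest place is just before the first letter of the left run.
  · obtain ⟨m, hm, hmin⟩ := Finset.exists_min_image (Finset.Icc 1 (l (s + 1)))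
      (fun m => w.idxOf (s + 1 + m)) ⟨1, Finset.mem_Icc.2 ⟨le_rfl, h0⟩⟩
    obtain ⟨hm1, hm2⟩ := Finset.mem_Icc.1 hm
    have hr0 : r (s + 1) = 0 := by omega
    obtain ⟨w', h1, h2, h3⟩ := hw.exists_insert hd hs
      (p := w.idxOf (s + 1 + m)) List.idxOf_le_length
      (fun m' h4 h5 => hmin m' (Finset.mem_Icc.2 ⟨h4, h5⟩))
      (fun h => hw.idxOf_lt_left hd h hm1 hm2) (by omega) (fun _ => by
        rw [hr0]
        exact hmin 1 (Finset.mem_Icc.2 ⟨le_rfl, h0⟩))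
    exact ⟨w', h1, h2, fun a ha ha' h _ => (h3 a ha ha').2 (h m hm1 hm2)⟩

/-- Only inversions involving the new letter `s + 1` are at stake. A letter `b` placed before it
despite early insertion in `σ` is forced there by a run; since `l' ≤ l` and `r ≤ r'`, the inversions
already transferred to `ν` force `b` before `s + 1` under late insertion too. -/
lemma exists_isCompatible_of_le {l' r' : ℕ → ℕ} (hd : IsTwinDiagram n l r)
    (hd' : IsTwinDiagram n l' r') (hl : ∀ i, 1 ≤ i → i ≤ n → l' i ≤ l i)
    (hr : ∀ i, 1 ≤ i → i ≤ n → r i ≤ r' i) (hs : s ≤ n) :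
    ∃ σ ν, IsCompatible n l r s σ ∧ IsCompatible n l' r' s ν ∧
      ∀ a b, s < a → a < b → b ≤ n → σ.idxOf b < σ.idxOf a → ν.idxOf b < ν.idxOf a := by
  induction hs using Nat.decreasingInduction with
  | self =>
    exact ⟨[], [], ⟨List.nodup_nil, fun a => by simp, fun i => by omega, fun i => by omega⟩,
      ⟨List.nodup_nil, fun a => by simp, fun i => by omega, fun i => by omega⟩, by simp⟩
  | of_succ s hs ih =>
    obtain ⟨σ, ν, hσ, hν, H⟩ := ih
    obtain ⟨σ', hσ', hσo, hσs⟩ := hσ.exists_insert_early hd hs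
    obtain ⟨ν', hν', hνo, hνs⟩ := hν.exists_insert_late hd' hs
    refine ⟨σ', ν', hσ', hν', fun a b ha hab hb hlt => ?_⟩
    rcases eq_or_ne a (s + 1) with rfl | hne
    swap
    · exact (hνo _ _ (by omega) hb (by omega) (by omega)).2 (H _ _ (by omega) hab hb
        ((hσo _ _ (by omega) hb (by omega) (by omega)).1 hlt))
    have hl1 := hl (s + 1) (by omega) (by omega)
    have hr1 := hr (s + 1) (by omega) (by omega)
    have hz' := hd'.eq_zero_iff (s + 1) (by omega) (by omega)
    rcases hσs b hab hb hlt with ⟨h0, hn, hle⟩ | ⟨h0, m, hm1, hm2, hle⟩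
    · have hbefore : ∀ m, 1 ≤ m → m ≤ l (s + 1) → σ.idxOf b < σ.idxOf (s + 1 + m) :=
        fun m hm1 hm2 => hle.trans_lt (hσ.idxOf_lt_left hd hn hm1 hm2)
      have hlb : s + 1 + l (s + 1) < b := by
        by_contra hcon
        have := hbefore (b - (s + 1)) (by omega) (by omega)
        rw [show s + 1 + (b - (s + 1)) = b by omega] at this
        exact lt_irrefl _ this
      have hbefore' : ∀ m, 1 ≤ m → m ≤ l (s + 1) → ν.idxOf b < ν.idxOf (s + 1 + m) :=
        fun m hm1 hm2 => H _ _ (by omega) (by omega) hb (hbefore m hm1 hm2)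
      -- If `l' (s + 1) = 0`, then `r' (s + 1) > 0`, and `b` precedes `s + 2`, which precedes the
      -- letter stopping the right run in `ν`.
      refine hνs b hab hb (fun m hm1 hm2 => hbefore' m hm1 (by omega)) fun h => ?_
      exact (hbefore' 1 le_rfl h0).trans (hν.idxOf_lt_right hd' hs le_rfl (by omega))
    · refine hνs b hab hb (fun m _ _ => by omega) fun _ => ?_
      -- Beyond the right run of `ν`, `b` forms an inversion of `σ` with `s + 1 + m`, which
      -- transfers to `ν`; inside that run, `b` precedes its stopping letter directly.
      rcases Nat.lt_or_ge (s + 1 + r' (s + 1)) b with hrb | hrb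
      · have hR := hd'.right_add_le (s + 1) (by omega) hs
        have hne : σ.idxOf b ≠ σ.idxOf (s + 1 + m) := fun he => by
          have := (List.idxOf_inj ((hσ.mem_iff b).2 ⟨hab, hb⟩)).1 he
          omega
        exact (H _ _ (by omega) (by omega) hb (lt_of_le_of_ne hle hne)).trans
          (hν.idxOf_lt_right hd' hs hm1 (by omega))
      · have := hν.idxOf_lt_right hd' hs (m := b - (s + 1)) (by omega) (by omega)
        rwa [show s + 1 + (b - (s + 1)) = b by omega] at this

end

/-! ### From runs back to diagrams, the words `ω` and the Baxter order. -/

lemma isTwinDiagram_of_mem {n : ℕ} {δ : List ℕ × List ℕ} (h : δ ∈ twinTamariDiagrams n) :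
    IsTwinDiagram n (letter δ.1) (letter δ.2) := by
  obtain ⟨⟨-, h1, h2⟩, ⟨-, h3, h4⟩, h5⟩ := h
  refine ⟨h1, h3, h2, h4, fun i hi hn => ?_⟩
  have := h5 i hi hn
  rw [xor_iff_iff_not] at this
  exact this

lemma eq_of_letter_eq {n : ℕ} {u v : List ℕ} (hu : u.length = n) (hv : v.length = n)
    (h : ∀ i, 1 ≤ i → i ≤ n → letter u i = letter v i) : u = v := by
  refine List.ext_getElem (hu.trans hv.symm) fun i h1 h2 => ?_
  have := h (i + 1) (by omega) (by omega)
  rwa [letter, letter, Nat.add_sub_cancel, List.getD_eq_getElem _ _ h1,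
    List.getD_eq_getElem _ _ h2] at this

lemma RunLength.eq {r : ℕ → ℕ → Prop} {N i k k' : ℕ} (hr : ∀ a b, r a b → ¬ r b a)
    (h : RunLength r N i k) (h' : RunLength r N i k') : k = k' :=
  le_antisymm (h'.le h fun _ _ _ hj => hr _ _ hj) (h.le h' fun _ _ _ hj => hr _ _ hj)

lemma IsCompatible.isPermutation {n : ℕ} {l r : ℕ → ℕ} {w : List ℕ}
    (hw : IsCompatible n l r 0 w) : IsPermutation n w :=
  perm_range'_iff.2 ⟨hw.nodup, fun a => by rw [hw.mem_iff]; omega⟩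

lemma IsCompatible.ttd_eq {n : ℕ} {δ : List ℕ × List ℕ} {w : List ℕ}
    (hδ : δ ∈ twinTamariDiagrams n) (hw : IsCompatible n (letter δ.1) (letter δ.2) 0 w) :
    ttd (twinTrees w) = δ := by
  have hp := hw.isPermutation
  obtain ⟨h1, h2⟩ := length_ttd_twinTrees hp
  refine Prod.ext (eq_of_letter_eq h1 hδ.1.1 fun i hi hn => ?_)
    (eq_of_letter_eq h2 hδ.2.1.1 fun i hi hn => ?_)
  · exact (runLength_ttd_fst hp hi hn).eq (fun _ _ => lt_asymm) (hw.left i hi hn)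
  · exact (runLength_ttd_snd hp hi hn).eq (fun _ _ => lt_asymm) (hw.right i hi hn)

lemma ttd_injective : Function.Injective ttd := fun _ _ h =>
  Prod.ext (td_injective (congrArg Prod.fst h)) (td_injective (congrArg Prod.snd h))

lemma bijOn_ttd (n : ℕ) : Set.BijOn ttd (twinBinaryTrees n) (twinTamariDiagrams n) := by
  refine ⟨fun J hJ => mem_twinBinaryTrees_iff.1 hJ, ttd_injective.injOn, fun δ hδ => ?_⟩
  have hd := isTwinDiagram_of_mem hδ
  obtain ⟨σ, -, hσ, -⟩ := exists_isCompatible_of_le hd hd (fun _ _ _ => le_rfl)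
    (fun _ _ _ => le_rfl) (Nat.zero_le n)
  have h := hσ.ttd_eq hδ
  exact ⟨twinTrees σ, mem_twinBinaryTrees_iff.2 (h ▸ hδ), h⟩

lemma letter_omegaWord {n : ℕ} {δ : List ℕ × List ℕ} (h1 : δ.1.length = n) (h2 : δ.2.length = n)
    {i : ℕ} (hi : 1 ≤ i) (hn : i ≤ n) :
    letter (omegaWord δ) i =
      if letter δ.1 i ≠ 0 then -((letter δ.1 i : ℕ) : ℤ) else ((letter δ.2 i : ℕ) : ℤ) := by
  have h3 : i - 1 < δ.1.length := by omega
  have h4 : i - 1 < δ.2.length := by omega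
  rw [letter, letter, letter, omegaWord, List.getD_eq_getElem _ _ h3, List.getD_eq_getElem _ _ h4,
    List.getD_eq_getElem _ _ (by rw [List.length_zipWith]; omega), List.getElem_zipWith]

/-- For `i < n` exactly one of the two letters is nonzero and the sign of `ω` tells which; for `i =
n` both vanish. -/
lemma letter_omegaWord_le_iff {n : ℕ} {δ δ' : List ℕ × List ℕ} (h : δ ∈ twinTamariDiagrams n)
    (h' : δ' ∈ twinTamariDiagrams n) {i : ℕ} (hi : 1 ≤ i) (hn : i ≤ n) :
    letter (omegaWord δ) i ≤ letter (omegaWord δ') i ↔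
      letter δ'.1 i ≤ letter δ.1 i ∧ letter δ.2 i ≤ letter δ'.2 i := by
  have hd := isTwinDiagram_of_mem h
  have hd' := isTwinDiagram_of_mem h'
  rw [letter_omegaWord h.1.1 h.2.1.1 hi hn, letter_omegaWord h'.1.1 h'.2.1.1 hi hn]
  have := hd.eq_zero_iff i hi
  have := hd'.eq_zero_iff i hi
  have := hd.left_add_le i hi hn
  have := hd.right_add_le i hi hn
  have := hd'.left_add_le i hi hn
  have := hd'.right_add_le i hi hn
  split_ifs <;> omega

/-- Upward, inversions persist, so `RunLength.le` compares the runs. Downward, the two permutations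
built from the diagrams witness the order. -/
lemma baxterLE_iff {n : ℕ} {J J' : BinaryTree Unit × BinaryTree Unit}
    (hJ : J ∈ twinBinaryTrees n) (hJ' : J' ∈ twinBinaryTrees n) :
    BaxterLE n J J' ↔ ∀ i, 1 ≤ i → i ≤ n →
      letter (ttd J').1 i ≤ letter (ttd J).1 i ∧ letter (ttd J).2 i ≤ letter (ttd J').2 i := by
  constructor
  · rintro ⟨σ, ν, hσ, hν, hle, rfl, rfl⟩ i hi hn
    have hσ' := perm_range'_iff.1 hσ
    have hinv := fun a b (hab : a < b) => hle.idxOf_lt hσ'.1 hab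
    constructor
    · exact (runLength_ttd_fst hσ hi hn).le (runLength_ttd_fst hν hi hn)
        fun j hj _ hlt => lt_asymm (hinv i j hj hlt)
    · refine (runLength_ttd_snd hν hi hn).le (runLength_ttd_snd hσ hi hn)
        fun j hj _ hlt hlt' => lt_asymm hlt (hinv i j hj hlt')
  · intro h
    have hδ := mem_twinBinaryTrees_iff.1 hJ
    have hδ' := mem_twinBinaryTrees_iff.1 hJ'
    obtain ⟨σ, ν, hσ, hν, H⟩ := exists_isCompatible_of_le (isTwinDiagram_of_mem hδ)
      (isTwinDiagram_of_mem hδ') (fun i hi hn => (h i hi hn).1) (fun i hi hn => (h i hi hn).2)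
      (Nat.zero_le n)
    refine ⟨σ, ν, hσ.isPermutation, hν.isPermutation,
      permutohedronLE_of_inversions hν.nodup
        (List.Perm.trans hσ.isPermutation (List.Perm.symm hν.isPermutation)) ?_,
      ttd_injective (hσ.ttd_eq hδ), ttd_injective (hν.ttd_eq hδ')⟩
    intro a ha b hb hab hlt
    exact H a b ((hν.mem_iff a).1 ha).1 hab ((hν.mem_iff b).1 hb).2 hlt

end Baxter

theorem mainTheorem7 (n : ℕ) :
    Set.BijOn Baxter.ttd (Baxter.twinBinaryTrees n) (Baxter.twinTamariDiagrams n) ∧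
    ∀ J₀ ∈ Baxter.twinBinaryTrees n, ∀ J₁ ∈ Baxter.twinBinaryTrees n,
      (Baxter.BaxterLE n J₀ J₁ ↔
        ∀ i : ℕ, 1 ≤ i → i ≤ n →
          Baxter.letter (Baxter.omegaWord (Baxter.ttd J₀)) i ≤
            Baxter.letter (Baxter.omegaWord (Baxter.ttd J₁)) i) := by
  refine ⟨Baxter.bijOn_ttd n, fun J₀ h₀ J₁ h₁ => ?_⟩
  rw [Baxter.baxterLE_iff h₀ h₁]
  exact forall_congr' fun i => forall_congr' fun hi => forall_congr' fun hn =>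
    (Baxter.letter_omegaWord_le_iff (Baxter.mem_twinBinaryTrees_iff.1 h₀)
      (Baxter.mem_twinBinaryTrees_iff.1 h₁) hi hn).symm
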